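/- Let $\Omega\subseteq\mathbb{R}^n$ be a domain (a nonempty open connected set), and let $\mathcal{M}^+(\Omega)$ be the class of nonnegative, locally finite Borel (Radon) measures on $\Omega$. Let $G:\Omega\times\Omega\to(0,+\infty]$ be a positive lower semicontinuous kernel, and for $\omega\in\mathcal{M}^+(\Omega)$ put $$\mathbf{G}\omega(x):=\int_\Omega G(x,y)\,d\omega(y)\in[0,+\infty],\qquad x\in\Omega.$$ The kernel $G$ satisfies the weak maximum principle if there is a constant $h\ge 1$ such that for every $\omega\in\mathcal{M}^+(\Omega)$, $$\sup\{\mathbf{G}\omega(x):x\in\operatorname{supp}(\omega)\}\le 1\ \Longrightarrow\ \sup\{\mathbf{G}\omega(x):x\in\Omega\}\le h,$$ and $G$ is quasi-symmetric if there is a constant $a\ge1$ such that $a^{-1}G(y,x)\le G(x,y)\le a\,G(y,x)$ for all $x,y\in\Omega$. For $0<p<\infty$, a measurable function $f:\Omega\to[0,+\infty]$ is said to belong to $L^p(\Omega,d\omega)$ if $\int_\Omega f^p\,d\omega<+\infty$. **Theorem 4.4.** Let $0<q<1$, $\gamma>0$, and let $\sigma,\mu\in\mathcal{M}^+(\Omega)$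 with $\sigma\not\equiv0$. Suppose that $G$ is a positive lower semicontinuous kernel on $\Omega\times\Omega$ which satisfies the weak maximum principle. Consider the conditions $$\mathbf{G}\sigma\in L^{\frac{\gamma+q}{1-q}}(\Omega,d\sigma)\qquad\text{and}\qquad \mathbf{G}\mu\in L^{\gamma}(\Omega,d\mu).\tag{1}$$ (i) If $G$ is moreover quasi-symmetric and both conditions in (1) hold, then there exists a positive solution $u\in L^{\gamma+q}(\Omega,d\sigma)\cap L^{\gamma}(\Omega,d\mu)$ of $$u=\mathbf{G}(u^q\,d\sigma)+\mathbf{G}\mu\quad\text{in }\Omega,\tag{2}$$ that is, a measurable function $u:\Omega\to(0,+\infty]$ in both spaces satisfying (2) at every point of $\Omega$. (ii) Conversely, without assuming quasi-symmetry: if there exists a positive solution $u\in L^{\gamma+q}(\Omega,d\sigma)\cap L^{\gamma}(\Omega,d\mu)$ of (2), then both conditions in (1) hold. -/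

import Mathlib

open MeasureTheory
open scoped ENNReal NNReal

namespace SublinearPotential

/-- The potential `𝐆ω(x) = ∫ G(x, y) dω(y)` of a measure `ω` with respect to the `[0, ∞]`-valued
kernel `G`; its values lie in `[0, ∞]`. -/
noncomputable def potential {X : Type*} [MeasurableSpace X] (G : X → X → ℝ≥0∞)
    (ω : Measure X) (x : X) : ℝ≥0∞ :=
  ∫⁻ y, G x y ∂ω

/-- The weak maximum principle: for some finite constant `h ≥ 1`, every locally finite Borel
measure `ω` whose potential is at most `1` on the (closed) support of `ω` has a potential that is
at most `h` everywhere. -/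
def WeakMaximumPrinciple {X : Type*} [TopologicalSpace X] [MeasurableSpace X]
    (G : X → X → ℝ≥0∞) : Prop :=
  ∃ h : ℝ≥0, 1 ≤ h ∧ ∀ ω : Measure X, IsLocallyFiniteMeasure ω →
    (⨆ x ∈ ω.support, potential G ω x) ≤ 1 → (⨆ x, potential G ω x) ≤ (h : ℝ≥0∞)

/-- Quasi-symmetry: `a⁻¹ G(y, x) ≤ G(x, y) ≤ a G(y, x)` for some finite constant `a ≥ 1`. -/
def QuasiSymmetric {X : Type*} (G : X → X → ℝ≥0∞) : Prop :=
  ∃ a : ℝ≥0, 1 ≤ a ∧ ∀ x y, (a : ℝ≥0∞)⁻¹ * G y x ≤ G x y ∧ G x y ≤ (a : ℝ≥0∞) * G y x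

/-- `u : X → (0, ∞]` is a positive (measurable) solution of the integral equation
`u = 𝐆(u^q dσ) + 𝐆μ`, which is required at every point. -/
structure IsPositiveSolution {X : Type*} [MeasurableSpace X] (G : X → X → ℝ≥0∞)
    (σ μ : Measure X) (q : ℝ) (u : X → ℝ≥0∞) : Prop where
  measurable : Measurable u
  pos : ∀ x, 0 < u x
  eq : ∀ x, u x = potential G (σ.withDensity fun y => u y ^ q) x + potential G μ x

end SublinearPotential

/-!
Both directions rest on one consequence of the maximum principle: the part of a measure `ω` carried
by the closed set `{Gω ≤ t}` has potential at most `h t` everywhere, so that if `Gω(x) > 2 h t`, at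
least half of `Gω(x)` comes from `{Gω > t}`. Two pointwise inequalities follow:
`(Gω)^r ≤ C G((Gω)^{r-1} dω)` for `r ≥ 1` (`rpow_potential_le`), and
`G((Gω)^{-q} dω) ≤ C (Gω)^{1-q}` for `0 < q < 1` (`exists_potential_withDensity_rpow_neg_le`).

Necessity. The bound on `Gμ` is immediate from `Gμ ≤ u`. With `ν = u^q dσ` one has `Gν ≤ u`, so
`Gσ = G(u^{-q} dν) ≤ G((Gν)^{-q} dν) ≤ C u^{1-q}`, and the integrability of `u` gives that of `Gσ`.

Sufficiency. Integrating potentials against each other and using quasi-symmetry, one gets for any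
two measures the level set estimate
`ω {Gν > t, Gω ≤ τ} ≤ C (τ / t) ν {Gν > t / (2h)}` (`mul_measure_potential_gt_inter_le`).
The choice `τ = δ t^{1-q}` and the layer cake formula turn it into
`∫ (Gν)^{γ+q} dω ≤ C_δ ∫ (Gω)^{(γ+q)/(1-q)} dω + C δ ∫ (Gν)^γ dν`
(`lintegral_min_potential_rpow_le`), valid for `0 ≤ q < 1`. It is used three times:
* with `ω = σ`, `ν = μ`, it puts `Gμ` into `L^{γ+q}(σ)`;
* with `ω = σ`, `ν = u^q dσ` and `δ` small, the last term is absorbed and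
  `∫ G(u^q dσ)^{γ+q} dσ ≤ C_ε ∫ (Gσ)^{(γ+q)/(1-q)} dσ + ε ∫ u^{γ+q} dσ`
  (`exists_lintegral_potential_withDensity_rpow_le`);
* with `q = 0`, `ω = μ`, `ν = u^q dσ`, it puts the solution into `L^γ(μ)`.

By the first inequality with `r = 1/(1-q)`, a small multiple of `(Gσ)^{1/(1-q)}` is a positive
subsolution. Monotone iteration of `v ↦ G(v^q dσ) + Gμ` from it stays bounded in `L^{γ+q}(σ)` by the
second use above, and its limit is the solution.
-/

namespace SublinearPotential

variable {X : Type*} [TopologicalSpace X] [MeasurableSpace X] {G : X → X → ℝ≥0∞}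

/-! ### Potentials and the maximum principle -/

section Basic

variable [SecondCountableTopology X] [BorelSpace X]

theorem measurable_uncurry_kernel (hG : LowerSemicontinuous (Function.uncurry G)) :
    Measurable (Function.uncurry G) :=
  hG.measurable

theorem measurable_kernel_left (hG : LowerSemicontinuous (Function.uncurry G)) (x : X) :
    Measurable (G x) :=
  hG.measurable.comp measurable_prodMk_left

/-- Fatou's lemma along the neighbourhood filter, which is countably generated. -/
theorem lowerSemicontinuous_potential (hG : LowerSemicontinuous (Function.uncurry G))
    (ω : Measure X) : LowerSemicontinuous (potential G ω) := by
  rw [lowerSemicontinuous_iff_le_liminf]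
  intro x
  have hx : ∀ y, G x y ≤ Filter.liminf (fun z => G z y) (nhds x) := fun y =>
    (lowerSemicontinuous_iff_le_liminf.1
      (hG.comp (continuous_id.prodMk (continuous_const (y := y))))) x
  calc potential G ω x ≤ ∫⁻ y, Filter.liminf (fun z => G z y) (nhds x) ∂ω := lintegral_mono hx
    _ ≤ _ := lintegral_liminf_le fun z => measurable_kernel_left hG z

theorem measurable_potential (hG : LowerSemicontinuous (Function.uncurry G))
    (ω : Measure X) : Measurable (potential G ω) :=
  (lowerSemicontinuous_potential hG ω).measurable

theorem isClosed_potential_le (hG : LowerSemicontinuous (Function.uncurry G))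
    (ω : Measure X) (t : ℝ≥0∞) : IsClosed {x | potential G ω x ≤ t} :=
  lowerSemicontinuous_iff_isClosed_preimage.1 (lowerSemicontinuous_potential hG ω) t

theorem potential_withDensity (hG : LowerSemicontinuous (Function.uncurry G)) (ω : Measure X)
    {f : X → ℝ≥0∞} (hf : Measurable f) (x : X) :
    potential G (ω.withDensity f) x = ∫⁻ y, G x y * f y ∂ω := by
  rw [potential, lintegral_withDensity_eq_lintegral_mul _ hf (measurable_kernel_left hG x)]
  simp [mul_comm]

omit [TopologicalSpace X] [SecondCountableTopology X] [BorelSpace X] in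
theorem potential_restrict_le (ω : Measure X) (s : Set X) (x : X) :
    potential G (ω.restrict s) x ≤ potential G ω x :=
  lintegral_mono' Measure.restrict_le_self le_rfl

theorem potential_pos (hG : LowerSemicontinuous (Function.uncurry G)) (hpos : ∀ x y, 0 < G x y)
    {ω : Measure X} (hω : ω ≠ 0) (x : X) : 0 < potential G ω x := by
  rw [potential, lintegral_pos_iff_support (measurable_kernel_left hG x)]
  have : Function.support (G x) = Set.univ := by
    ext y; simp [(hpos x y).ne']
  rw [this]
  exact (Measure.measure_univ_pos).2 hω

/-- A positive lower semicontinuous kernel is bounded below near each point, so a measure whose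
potential is finite somewhere is locally finite. -/
theorem isLocallyFiniteMeasure_of_potential_ne_top
    (hG : LowerSemicontinuous (Function.uncurry G)) (hpos : ∀ x y, 0 < G x y)
    {ω : Measure X} {x : X} (hx : potential G ω x ≠ ∞) : IsLocallyFiniteMeasure ω := by
  refine ⟨fun y => ?_⟩
  obtain ⟨c, hc0, hc⟩ := exists_between (hpos x y)
  have hlsc : LowerSemicontinuous (G x) := hG.comp (continuous_const.prodMk continuous_id)
  refine ⟨{z | c < G x z}, hlsc y c hc, ?_⟩
  have hmar := meas_ge_le_lintegral_div (μ := ω) (measurable_kernel_left hG x).aemeasurable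
    hc0.ne' (ne_top_of_lt hc)
  calc ω {z | c < G x z} ≤ ω {z | c ≤ G x z} := measure_mono fun z (hz : c < G x z) => hz.le
    _ ≤ _ := hmar
    _ < ∞ := ENNReal.div_lt_top hx hc0.ne'

/-- The maximum principle with constant `h` in the form in which it is applied: a potential that is
at most `t` on a closed set carrying the measure is at most `h * t` everywhere. The measure is not
required to be locally finite. -/
def MaximumPrincipleWith (G : X → X → ℝ≥0∞) (h : ℝ≥0) : Prop :=
  ∀ (ω : Measure X) (E : Set X) (t : ℝ≥0∞), t ≠ 0 → IsClosed E → ω Eᶜ = 0 →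
    (∀ x ∈ E, potential G ω x ≤ t) → ∀ x, potential G ω x ≤ h * t

theorem WeakMaximumPrinciple.exists_maximumPrincipleWith
    (hG : LowerSemicontinuous (Function.uncurry G)) (hpos : ∀ x y, 0 < G x y)
    (hwmp : WeakMaximumPrinciple G) : ∃ h : ℝ≥0, 1 ≤ h ∧ MaximumPrincipleWith G h := by
  obtain ⟨h, h1, hw⟩ := hwmp
  refine ⟨h, h1, fun ω E t ht0 hE hωE hle x => ?_⟩
  have hh0 : (h : ℝ≥0∞) ≠ 0 := by
    simpa using (zero_lt_one.trans_le h1).ne'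
  rcases eq_or_ne t ∞ with rfl | htop
  · simp [ENNReal.mul_top hh0]
  rcases eq_or_ne ω 0 with rfl | hω
  · simp [potential]
  have hne : E.Nonempty := by
    rw [Set.nonempty_iff_ne_empty]
    rintro rfl
    simp [hω] at hωE
  obtain ⟨z, hz⟩ := hne
  have hloc : IsLocallyFiniteMeasure ω :=
    isLocallyFiniteMeasure_of_potential_ne_top hG hpos
      (ne_top_of_le_ne_top htop (hle z hz))
  -- Normalize to `t = 1`.
  have hscale : ∀ y, potential G (t⁻¹ • ω) y = t⁻¹ * potential G ω y := fun y => by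
    simp [potential, lintegral_smul_measure]
  have hloc' : IsLocallyFiniteMeasure (t⁻¹ • ω) := by
    obtain ⟨r, hr⟩ : ∃ r : ℝ≥0, t⁻¹ = r :=
      ⟨t⁻¹.toNNReal, (ENNReal.coe_toNNReal (ENNReal.inv_ne_top.2 ht0)).symm⟩
    rw [hr]
    exact inferInstanceAs (IsLocallyFiniteMeasure (r • ω))
  have hsupp : (t⁻¹ • ω).support ⊆ E := by
    refine Measure.support_subset_of_isClosed hE ?_
    rw [mem_ae_iff]
    simp [hωE]
  have := hw _ hloc' (iSup₂_le fun y hy => by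
    rw [hscale, mul_comm, ← div_eq_mul_inv]
    exact ENNReal.div_le_of_le_mul (by simpa using hle y (hsupp hy)))
  have hx := (le_iSup (fun y => potential G (t⁻¹ • ω) y) x).trans this
  rw [hscale, mul_comm, ← div_eq_mul_inv] at hx
  exact (ENNReal.div_le_iff ht0 htop).1 hx

theorem potential_restrict_potential_le_le
    (hG : LowerSemicontinuous (Function.uncurry G)) {h : ℝ≥0} (hmax : MaximumPrincipleWith G h)
    (ω : Measure X) {t : ℝ≥0∞} (ht : t ≠ 0) (x : X) :
    potential G (ω.restrict {y | potential G ω y ≤ t}) x ≤ h * t := by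
  have hE := isClosed_potential_le hG ω t
  refine hmax _ _ t ht hE ?_ (fun y hy => (potential_restrict_le _ _ _).trans hy) x
  rw [Measure.restrict_apply hE.measurableSet.compl]
  simp

/-- Deleting the part of `ω` where its potential is at most `t` costs at most `h * t`. -/
theorem potential_le_add_restrict
    (hG : LowerSemicontinuous (Function.uncurry G)) {h : ℝ≥0} (hmax : MaximumPrincipleWith G h)
    (ω : Measure X) {t : ℝ≥0∞} (ht : t ≠ 0) (x : X) :
    potential G ω x ≤ h * t + potential G (ω.restrict {y | t < potential G ω y}) x := by
  have hE := (isClosed_potential_le hG ω t).measurableSet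
  have hc : {y | t < potential G ω y} = {y | potential G ω y ≤ t}ᶜ := by
    ext y; simp
  calc potential G ω x
      = potential G (ω.restrict {y | potential G ω y ≤ t}) x
        + potential G (ω.restrict {y | t < potential G ω y}) x := by
        rw [hc]
        exact (lintegral_add_compl _ hE).symm
    _ ≤ _ := by
        gcongr
        exact potential_restrict_potential_le_le hG hmax ω ht x

/-- If `Gω(x) ≥ t`, then half of `t` comes from the set where `Gω > t / (2h)`. -/
theorem half_le_potential_restrict
    (hG : LowerSemicontinuous (Function.uncurry G)) {h : ℝ≥0} (h1 : 1 ≤ h)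
    (hmax : MaximumPrincipleWith G h)
    (ω : Measure X) {t : ℝ≥0∞} (ht : t ≠ 0) (htop : t ≠ ∞) {x : X} (hx : t ≤ potential G ω x) :
    t / 2 ≤ potential G (ω.restrict {y | t < 2 * h * potential G ω y}) x := by
  have hh0 : (h : ℝ≥0∞) ≠ 0 := by
    simpa using (zero_lt_one.trans_le h1).ne'
  have h20 : (2 * h : ℝ≥0∞) ≠ 0 := mul_ne_zero two_ne_zero hh0
  have h2top : (2 * h : ℝ≥0∞) ≠ ∞ := ENNReal.mul_ne_top ENNReal.ofNat_ne_top ENNReal.coe_ne_top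
  have hset : {y | t < 2 * h * potential G ω y} = {y | t / (2 * h) < potential G ω y} := by
    ext y
    simp only [Set.mem_ofPred_eq]
    rw [ENNReal.div_lt_iff (Or.inl h20) (Or.inl h2top), mul_comm]
  have hhalf : (h : ℝ≥0∞) * (t / (2 * h)) = t / 2 := by
    rw [mul_comm (2 : ℝ≥0∞), ← mul_div_assoc, ENNReal.mul_div_mul_left _ _ hh0 ENNReal.coe_ne_top]
  have key := potential_le_add_restrict hG hmax ω (t := t / (2 * h))
    (ENNReal.div_pos ht h2top).ne' x
  rw [hhalf] at key
  rw [hset]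
  have h3 : t / 2 + t / 2 ≤ t / 2 +
      potential G (ω.restrict {y | t / (2 * h) < potential G ω y}) x := by
    rw [ENNReal.add_halves]
    exact hx.trans key
  exact (ENNReal.add_le_add_iff_left (ENNReal.div_ne_top htop two_ne_zero)).1 h3

end Basic

/-! ### Pointwise inequalities for powers of potentials -/

section Pointwise

variable [SecondCountableTopology X] [BorelSpace X]

/-- On the set `{Gω > t / (2h)}`, which carries half of `t ≤ Gω(x)`, the weight `(Gω)^{r-1}` is at
least `(t / (2h))^{r-1}`; take `t = Gω(x)`, or `t` arbitrarily large if `Gω(x) = ∞`. -/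
theorem rpow_potential_le
    (hG : LowerSemicontinuous (Function.uncurry G)) {h : ℝ≥0} (h1 : 1 ≤ h)
    (hmax : MaximumPrincipleWith G h) (ω : Measure X) {r : ℝ} (hr : 1 ≤ r) (x : X) :
    potential G ω x ^ r ≤ 2 * (2 * h : ℝ≥0∞) ^ (r - 1) *
      potential G (ω.withDensity fun y => potential G ω y ^ (r - 1)) x := by
  have hr0 : 0 < r := zero_lt_one.trans_le hr
  have hr1 : 0 ≤ r - 1 := sub_nonneg.2 hr
  have hmeas := measurable_potential hG ω
  set R := potential G (ω.withDensity fun y => potential G ω y ^ (r - 1)) x with hR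
  have key : ∀ t : ℝ≥0∞, t ≠ ∞ → t ≤ potential G ω x →
      t ^ r ≤ 2 * (2 * h : ℝ≥0∞) ^ (r - 1) * R := by
    intro t htop hx
    rcases eq_or_ne t 0 with rfl | ht
    · simp [ENNReal.zero_rpow_of_pos hr0]
    have hhalf := half_le_potential_restrict hG h1 hmax ω ht htop hx
    set S := {y | t < 2 * h * potential G ω y} with hS
    have hGg : Measurable fun y => G x y * potential G ω y ^ (r - 1) :=
      (measurable_kernel_left hG x).mul (hmeas.pow_const _)
    have h2 : t ^ (r - 1) * potential G (ω.restrict S) x ≤ (2 * h : ℝ≥0∞) ^ (r - 1) * R := by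
      rw [hR, potential_withDensity hG _ (hmeas.pow_const _), potential,
        ← lintegral_const_mul _ (measurable_kernel_left hG x),
        
        ← lintegral_const_mul _ hGg]
      have hSm : MeasurableSet S := measurableSet_lt measurable_const (hmeas.const_mul _)
      calc ∫⁻ y in S, t ^ (r - 1) * G x y ∂ω
          ≤ ∫⁻ y in S, (2 * h : ℝ≥0∞) ^ (r - 1) * (G x y * potential G ω y ^ (r - 1)) ∂ω := by
            refine setLIntegral_mono' hSm fun y hy => ?_
            calc t ^ (r - 1) * G x y ≤ (2 * h * potential G ω y) ^ (r - 1) * G x y := by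
                  gcongr
                  exact (show t < 2 * h * potential G ω y from hy).le
              _ = _ := by rw [ENNReal.mul_rpow_of_nonneg _ _ hr1]; ring
        _ ≤ _ := setLIntegral_le_lintegral _ _
    calc t ^ r = t ^ (r - 1) * t := by
          conv_lhs => rw [show r = (r - 1) + 1 by ring, ENNReal.rpow_add _ _ ht htop,
            ENNReal.rpow_one]
      _ = 2 * (t ^ (r - 1) * (t / 2)) := by
          rw [mul_left_comm, ENNReal.mul_div_cancel two_ne_zero ENNReal.ofNat_ne_top]
      _ ≤ 2 * (t ^ (r - 1) * potential G (ω.restrict S) x) := by gcongr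
      _ ≤ 2 * ((2 * h : ℝ≥0∞) ^ (r - 1) * R) := by gcongr
      _ = _ := by ring
  rcases eq_or_ne (potential G ω x) ∞ with htop | htop
  · rw [htop, ENNReal.top_rpow_of_pos hr0, top_le_iff]
    refine ENNReal.eq_top_of_forall_nnreal_le fun t => ?_
    have := key (((t : ℝ≥0∞)) ^ (1 / r))
      (ENNReal.rpow_ne_top_of_nonneg (by positivity) ENNReal.coe_ne_top) (by rw [htop]; exact le_top)
    rwa [← ENNReal.rpow_mul, one_div_mul_cancel hr0.ne', ENNReal.rpow_one] at this
  · exact key _ htop le_rfl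

/-- A point `y` with `0 < v ≤ T` lies in a dyadic shell `2^{-(k+1)} T < v ≤ 2^{-k} T`. -/
theorem rpow_neg_le_add_tsum {q : ℝ} (hq : 0 < q) {T v : ℝ≥0∞} (hT0 : T ≠ 0) (hT : T ≠ ∞)
    (hv : v ≠ 0) :
    v ^ (-q) ≤ T ^ (-q) +
      ∑' k : ℕ, (T * 2⁻¹ ^ (k + 1)) ^ (-q) * Set.indicator {w | w ≤ T * 2⁻¹ ^ k} 1 v := by
  rcases le_total T v with hle | hle
  · refine le_add_right ?_
    rw [ENNReal.rpow_neg, ENNReal.rpow_neg, ENNReal.inv_le_inv]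
    exact ENNReal.rpow_le_rpow hle hq.le
  · have hvT : v ≠ ∞ := ne_top_of_le_ne_top hT hle
    obtain ⟨k, hk1, hk2⟩ : ∃ k : ℕ, T * 2⁻¹ ^ (k + 1) < v ∧ v ≤ T * 2⁻¹ ^ k := by
      lift v to ℝ≥0 using hvT
      lift T to ℝ≥0 using hT
      have hT0' : 0 < T := pos_iff_ne_zero.2 (by exact_mod_cast hT0)
      have hv0' : 0 < v := pos_iff_ne_zero.2 (by exact_mod_cast hv)
      have hle' : v ≤ T := by exact_mod_cast hle
      obtain ⟨k, hk1, hk2⟩ := exists_nat_pow_near_of_lt_one (x := v / T) (y := (2⁻¹ : ℝ≥0))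
        (by positivity) (div_le_one_of_le₀ hle' hT0'.le) (by positivity)
        (inv_lt_one_of_one_lt₀ one_lt_two)
      refine ⟨k, ?_, ?_⟩
      · have := (lt_div_iff₀ hT0').1 hk1
        rw [mul_comm] at this
        have h2 : ((T * 2⁻¹ ^ (k + 1) : ℝ≥0) : ℝ≥0∞) < v := by exact_mod_cast this
        simpa [ENNReal.inv_pow] using h2
      · have := (div_le_iff₀ hT0').1 hk2
        rw [mul_comm] at this
        have h2 : (v : ℝ≥0∞) ≤ ((T * 2⁻¹ ^ k : ℝ≥0) : ℝ≥0∞) := by exact_mod_cast this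
        simpa [ENNReal.inv_pow] using h2
    refine le_add_left ?_
    refine le_trans ?_ (ENNReal.le_tsum k)
    rw [Set.indicator_of_mem (by exact hk2), Pi.one_apply, mul_one, ENNReal.rpow_neg,
      ENNReal.rpow_neg, ENNReal.inv_le_inv]
    exact ENNReal.rpow_le_rpow hk1.le hq.le

/-- Split into the shells `{2^{-(k+1)} T < Gω ≤ 2^{-k} T}`, `T = Gω(x)`: each contributes at most
`(2^{-(k+1)} T)^{-q} * (h * 2^{-k} T)` by the maximum principle, and these terms form a geometric
series because `q < 1`. -/
theorem exists_potential_withDensity_rpow_neg_le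
    (hG : LowerSemicontinuous (Function.uncurry G)) (hpos : ∀ x y, 0 < G x y) {h : ℝ≥0}
    (hmax : MaximumPrincipleWith G h) {q : ℝ} (hq0 : 0 < q) (hq1 : q < 1) :
    ∃ C : ℝ≥0, ∀ (ω : Measure X) (x : X),
      potential G (ω.withDensity fun y => potential G ω y ^ (-q)) x
        ≤ C * potential G ω x ^ (1 - q) := by
  set ρ : ℝ≥0∞ := (2⁻¹ : ℝ≥0∞) ^ (1 - q) with hρ
  have hρ1 : ρ < 1 := ENNReal.rpow_lt_one (by simp) (by linarith)
  set C : ℝ≥0∞ := 1 + (2⁻¹ : ℝ≥0∞) ^ (-q) * h * ∑' k : ℕ, ρ ^ k with hC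
  have hCtop : C ≠ ∞ := by
    rw [hC, ENNReal.tsum_geometric]
    refine ENNReal.add_ne_top.2 ⟨ENNReal.one_ne_top, ENNReal.mul_ne_top (ENNReal.mul_ne_top ?_
      ENNReal.coe_ne_top) ?_⟩
    · rw [ENNReal.inv_rpow, ← ENNReal.rpow_neg, neg_neg]
      exact ENNReal.rpow_ne_top_of_nonneg hq0.le ENNReal.ofNat_ne_top
    · exact ENNReal.inv_ne_top.2 (tsub_pos_of_lt hρ1).ne'
  refine ⟨C.toNNReal, fun ω x => ?_⟩
  rw [ENNReal.coe_toNNReal hCtop]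
  have hmeas := measurable_potential hG ω
  rcases eq_or_ne ω 0 with rfl | hω
  · simp [potential]
  have hp := potential_pos hG hpos hω
  set T := potential G ω x with hT
  rcases eq_or_ne T ∞ with htop | htop
  · have hC0 : C ≠ 0 := (lt_of_lt_of_le zero_lt_one (by rw [hC]; exact le_self_add)).ne'
    rw [htop, ENNReal.top_rpow_of_pos (by linarith), ENNReal.mul_top hC0]
    exact le_top
  have hT0 : T ≠ 0 := (hp x).ne'
  have hGx := measurable_kernel_left hG x
  have hEk : ∀ k : ℕ, MeasurableSet {y | potential G ω y ≤ T * 2⁻¹ ^ k} := fun k =>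
    (isClosed_potential_le hG ω _).measurableSet
  have hind : ∀ (k : ℕ) (y : X), Set.indicator {w | w ≤ T * 2⁻¹ ^ k} (1 : ℝ≥0∞ → ℝ≥0∞)
      (potential G ω y) = Set.indicator {y | potential G ω y ≤ T * 2⁻¹ ^ k} 1 y := by
    intro k y
    simp [Set.indicator_apply]
  have hterm : ∀ k : ℕ, (T * 2⁻¹ ^ (k + 1)) ^ (-q) * (h * (T * 2⁻¹ ^ k))
      = (2⁻¹ : ℝ≥0∞) ^ (-q) * h * T ^ (1 - q) * ρ ^ k := by
    intro k
    have e1 : ∀ n : ℕ, ((2⁻¹ : ℝ≥0∞) ^ n) ≠ ∞ := fun n => ENNReal.pow_ne_top (by simp)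
    have e2 : ((2⁻¹ : ℝ≥0∞) ^ k) ≠ 0 := pow_ne_zero _ (by simp)
    have e3 : ρ ^ k = ((2⁻¹ : ℝ≥0∞) ^ k) ^ (-q) * (2⁻¹ : ℝ≥0∞) ^ k := by
      conv_rhs => rw [← ENNReal.rpow_one ((2⁻¹ : ℝ≥0∞) ^ k), ← ENNReal.rpow_mul, one_mul]
      rw [← ENNReal.rpow_add _ _ e2 (e1 k), hρ, ← ENNReal.rpow_natCast, ← ENNReal.rpow_mul,
        ← ENNReal.rpow_natCast, ← ENNReal.rpow_mul]
      congr 1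
      ring
    have e4 : T ^ (1 - q) = T ^ (-q) * T := by
      rw [show 1 - q = -q + 1 by ring, ENNReal.rpow_add _ _ hT0 htop, ENNReal.rpow_one]
    rw [ENNReal.mul_rpow_of_ne_top htop (e1 _), pow_succ, ENNReal.mul_rpow_of_ne_top (e1 _)
      (by simp), e3, e4]
    ring
  rw [potential_withDensity hG _ (hmeas.pow_const _)]
  calc ∫⁻ y, G x y * potential G ω y ^ (-q) ∂ω
      ≤ ∫⁻ y, (G x y * T ^ (-q) + ∑' k : ℕ, (T * 2⁻¹ ^ (k + 1)) ^ (-q) *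
          Set.indicator {y | potential G ω y ≤ T * 2⁻¹ ^ k} (G x) y) ∂ω := by
        refine lintegral_mono fun y => ?_
        refine (mul_le_mul_right (rpow_neg_le_add_tsum hq0 hT0 htop (hp y).ne') _).trans ?_
        rw [mul_add, ← ENNReal.tsum_mul_left]
        refine add_le_add_right (ENNReal.tsum_le_tsum fun k => ?_) _
        rw [hind]
        by_cases hy : y ∈ {y | potential G ω y ≤ T * 2⁻¹ ^ k}
        · simp only [Set.indicator_of_mem hy, Pi.one_apply, mul_one]
          rw [mul_comm]
        · simp [Set.indicator_of_notMem hy]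
    _ = T * T ^ (-q) + ∑' k : ℕ, (T * 2⁻¹ ^ (k + 1)) ^ (-q) *
          potential G (ω.restrict {y | potential G ω y ≤ T * 2⁻¹ ^ k}) x := by
        rw [lintegral_add_left (hGx.mul_const _), lintegral_mul_const _ hGx, lintegral_tsum
          fun k => ((hGx.indicator (hEk k)).const_mul _).aemeasurable]
        congr 1
        refine tsum_congr fun k => ?_
        rw [lintegral_const_mul _ (hGx.indicator (hEk k)), lintegral_indicator (hEk k)]
        rfl
    _ ≤ T * T ^ (-q) + ∑' k : ℕ, (T * 2⁻¹ ^ (k + 1)) ^ (-q) * (h * (T * 2⁻¹ ^ k)) := by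
        gcongr with k
        exact potential_restrict_potential_le_le hG hmax ω
          (mul_ne_zero hT0 (pow_ne_zero _ (by simp))) x
    _ = C * T ^ (1 - q) := by
        simp_rw [hterm]
        rw [ENNReal.tsum_mul_left, hC, show 1 - q = 1 + -q by ring,
          ENNReal.rpow_add _ _ hT0 htop, ENNReal.rpow_one]
        ring

end Pointwise

/-! ### Comparing level sets of potentials of two measures -/

section LayerCake

theorem tendsto_min_natCast_atTop (x : ℝ≥0∞) :
    Filter.Tendsto (fun n : ℕ => min x n) Filter.atTop (nhds x) := by
  simpa using (tendsto_const_nhds (x := x)).min ENNReal.tendsto_nat_nhds_top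

omit [TopologicalSpace X] in
theorem measurable_measure_ofReal_lt (α : Measure X) (f : X → ℝ≥0∞) :
    Measurable fun t : ℝ => α {x | ENNReal.ofReal t < f x} :=
  Antitone.measurable fun _ _ htt => measure_mono fun _ hx =>
    (ENNReal.ofReal_le_ofReal htt).trans_lt hx

omit [TopologicalSpace X] in
/-- The layer cake formula for a function with values in `[0, ∞]`. -/
theorem lintegral_rpow_eq_lintegral_meas_ofReal_lt_mul (α : Measure X) {g : X → ℝ≥0∞}
    (hg : Measurable g) {s : ℝ} (hs : 0 < s) :
    ∫⁻ x, g x ^ s ∂α = ENNReal.ofReal s *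
      ∫⁻ t in Set.Ioi (0 : ℝ), α {x | ENNReal.ofReal t < g x} * ENNReal.ofReal (t ^ (s - 1)) := by
  have hmin : ∀ n : ℕ, Measurable fun x => min (g x) n := fun n => hg.min measurable_const
  have hfin : ∀ n : ℕ, ∫⁻ x, min (g x) n ^ s ∂α = ENNReal.ofReal s *
      ∫⁻ t in Set.Ioi (0 : ℝ),
        α {x | ENNReal.ofReal t < min (g x) n} * ENNReal.ofReal (t ^ (s - 1)) := by
    intro n
    have hne : ∀ x, min (g x) n ≠ ∞ := fun x =>
      ne_top_of_le_ne_top (ENNReal.natCast_ne_top n) (min_le_right _ _)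
    have := lintegral_rpow_eq_lintegral_meas_lt_mul α (f := fun x => (min (g x) n).toReal)
      (Filter.Eventually.of_forall fun x => ENNReal.toReal_nonneg)
      (hmin n).ennreal_toReal.aemeasurable hs
    refine (lintegral_congr fun x => ?_).trans (this.trans (congrArg _ ?_))
    · rw [← ENNReal.ofReal_rpow_of_nonneg ENNReal.toReal_nonneg hs.le,
        ENNReal.ofReal_toReal (hne x)]
    · refine setLIntegral_congr_fun measurableSet_Ioi fun t ht => ?_
      simp only [ENNReal.ofReal_lt_iff_lt_toReal (show (0 : ℝ) ≤ t from le_of_lt ht) (hne _)]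
  have hpow : Measurable fun t : ℝ => ENNReal.ofReal (t ^ (s - 1)) := by fun_prop
  have hmono : ∀ x, Monotone fun n : ℕ => min (g x) (n : ℝ≥0∞) := fun x n m hnm =>
    min_le_min_left _ (by exact_mod_cast hnm)
  have h1 : Filter.Tendsto (fun n : ℕ => ∫⁻ x, min (g x) n ^ s ∂α) Filter.atTop
      (nhds (∫⁻ x, g x ^ s ∂α)) := by
    refine lintegral_tendsto_of_tendsto_of_monotone (fun n => ((hmin n).pow_const _).aemeasurable)
      (.of_forall fun x n m hnm => ENNReal.rpow_le_rpow (hmono x hnm) hs.le)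
      (.of_forall fun x => (tendsto_min_natCast_atTop (g x)).ennrpow_const s)
  have h2 : Filter.Tendsto (fun n : ℕ => ENNReal.ofReal s * ∫⁻ t in Set.Ioi (0 : ℝ),
        α {x | ENNReal.ofReal t < min (g x) n} * ENNReal.ofReal (t ^ (s - 1))) Filter.atTop
      (nhds (ENNReal.ofReal s * ∫⁻ t in Set.Ioi (0 : ℝ),
        α {x | ENNReal.ofReal t < g x} * ENNReal.ofReal (t ^ (s - 1)))) := by
    refine ENNReal.Tendsto.const_mul ?_ (Or.inr ENNReal.ofReal_ne_top)
    have hsub : ∀ t : ℝ, Monotone fun n : ℕ => {x | ENNReal.ofReal t < min (g x) (n : ℝ≥0∞)} :=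
      fun t n m hnm x hx => lt_of_lt_of_le hx (hmono x hnm)
    refine lintegral_tendsto_of_tendsto_of_monotone
      (fun n => ((measurable_measure_ofReal_lt α _).mul hpow).aemeasurable)
      (.of_forall fun t n m hnm => mul_le_mul_left (measure_mono (hsub t hnm)) _)
      (.of_forall fun t => ENNReal.Tendsto.mul_const ?_ (Or.inr ENNReal.ofReal_ne_top))
    have hU : {x | ENNReal.ofReal t < g x}
        = ⋃ n : ℕ, {x | ENNReal.ofReal t < min (g x) (n : ℝ≥0∞)} := by
      ext x
      simp only [Set.mem_ofPred_eq, Set.mem_iUnion, lt_min_iff]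
      constructor
      · intro hx
        obtain ⟨n, hn⟩ := ENNReal.exists_nat_gt (r := ENNReal.ofReal t) ENNReal.ofReal_ne_top
        exact ⟨n, hx, hn⟩
      · rintro ⟨n, hx, -⟩
        exact hx
    rw [hU]
    exact tendsto_measure_iUnion_atTop (hsub t)
  exact tendsto_nhds_unique h1 (by simpa only [hfin] using h2)

end LayerCake

section Comparison

variable [SecondCountableTopology X] [BorelSpace X]

omit [TopologicalSpace X] [SecondCountableTopology X] [BorelSpace X] in
/-- Tonelli's theorem together with `G(x, y) ≤ a G(y, x)`. -/
theorem lintegral_potential_le_of_quasiSymmetric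
    (hG : Measurable (Function.uncurry G)) {a : ℝ≥0}
    (ha : ∀ x y, G x y ≤ a * G y x) (ω ν : Measure X) [SFinite ω] [SFinite ν] :
    ∫⁻ x, potential G ν x ∂ω ≤ a * ∫⁻ y, potential G ω y ∂ν := by
  have hG' : ∀ y, Measurable (G y) := fun y => hG.comp measurable_prodMk_left
  calc ∫⁻ x, ∫⁻ y, G x y ∂ν ∂ω = ∫⁻ y, ∫⁻ x, G x y ∂ω ∂ν :=
        lintegral_lintegral_swap hG.aemeasurable
    _ ≤ ∫⁻ y, a * potential G ω y ∂ν := by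
        refine lintegral_mono fun y => ?_
        rw [potential, ← lintegral_const_mul _ (hG' y)]
        exact lintegral_mono fun x => ha x y
    _ = _ := lintegral_const_mul' _ _ ENNReal.coe_ne_top

/-- On `F = {Gν > t, Gω ≤ τ}` half of `t` comes from the part of `ν` on `S = {Gν > t / (2h)}`, while
the potential of `ω` restricted to `F` is at most `h τ` everywhere; integrate `G(ν|_S)` against
`ω|_F` in both orders. -/
theorem mul_measure_potential_gt_inter_le
    (hG : LowerSemicontinuous (Function.uncurry G)) {h : ℝ≥0} (h1 : 1 ≤ h)
    (hmax : MaximumPrincipleWith G h) {a : ℝ≥0} (ha : ∀ x y, G x y ≤ a * G y x)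
    (ω ν : Measure X) [SFinite ω] [SFinite ν] {t τ : ℝ≥0∞} (ht : t ≠ 0) (htop : t ≠ ∞)
    (hτ : τ ≠ 0) :
    t * ω {x | t < potential G ν x ∧ potential G ω x ≤ τ}
      ≤ 2 * a * h * τ * ν {x | t < 2 * h * potential G ν x} := by
  have hν := measurable_potential hG ν
  have hE := isClosed_potential_le hG ω τ
  set F := {x | t < potential G ν x ∧ potential G ω x ≤ τ} with hF
  set S := {x | t < 2 * h * potential G ν x} with hS
  have hFm : MeasurableSet F :=
    (measurableSet_lt measurable_const hν).inter hE.measurableSet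
  have hωF : ∀ y, potential G (ω.restrict F) y ≤ h * τ := by
    refine hmax _ _ τ hτ hE ?_ fun y hy => (potential_restrict_le _ _ _).trans hy
    rw [Measure.restrict_apply hE.measurableSet.compl]
    convert measure_empty (μ := ω)
    ext y
    simp only [Set.mem_inter_iff, Set.mem_compl_iff, Set.mem_empty_iff_false, iff_false]
    rintro ⟨h1, h2⟩
    exact h1 h2.2
  have key : t / 2 * ω F ≤ a * (h * τ * ν S) := by
    calc t / 2 * ω F = ∫⁻ _ in F, t / 2 ∂ω := by simp
      _ ≤ ∫⁻ x in F, potential G (ν.restrict S) x ∂ω :=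
          setLIntegral_mono' hFm fun x hx =>
            half_le_potential_restrict hG h1 hmax ν ht htop hx.1.le
      _ ≤ a * ∫⁻ y in S, potential G (ω.restrict F) y ∂ν :=
          lintegral_potential_le_of_quasiSymmetric (measurable_uncurry_kernel hG) ha _ _
      _ ≤ a * ∫⁻ _ in S, h * τ ∂ν := by
          gcongr with y
          exact hωF y
      _ = _ := by simp
  calc t * ω F = 2 * (t / 2 * ω F) := by
        rw [← mul_assoc, ENNReal.mul_div_cancel two_ne_zero ENNReal.ofNat_ne_top]
    _ ≤ 2 * (a * (h * τ * ν S)) := by gcongr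
    _ = _ := by ring

/-- The level set estimate at `τ = δ t ^ (1 - q)`, integrated in `t` with weight `t ^ (γ + q - 1)`.
The truncation at height `N` is present on both sides, so that it can be used before the left-hand
side is known to be finite. -/
theorem lintegral_min_potential_rpow_le
    (hG : LowerSemicontinuous (Function.uncurry G)) {h : ℝ≥0} (h1 : 1 ≤ h)
    (hmax : MaximumPrincipleWith G h) {a : ℝ≥0} (ha : ∀ x y, G x y ≤ a * G y x)
    (ω ν : Measure X) [SFinite ω] [SFinite ν] {q γ : ℝ} (hq0 : 0 ≤ q) (hq1 : q < 1) (hγ : 0 < γ)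
    {δ : ℝ≥0} (hδ : δ ≠ 0) (N : ℝ≥0∞) :
    ∫⁻ x, min (potential G ν x) N ^ (γ + q) ∂ω
      ≤ ∫⁻ x, ((δ : ℝ≥0∞)⁻¹ * potential G ω x) ^ ((γ + q) / (1 - q)) ∂ω
        + 2 * a * h * δ * ENNReal.ofReal ((γ + q) / γ) *
          ∫⁻ x, min (2 * h * potential G ν x) N ^ γ ∂ν := by
  have hs : 0 < γ + q := by linarith
  have hq : 0 < 1 - q := by linarith
  have hν := measurable_potential hG ν
  have hω := measurable_potential hG ω
  have hδ0 : (δ : ℝ≥0∞) ≠ 0 := by exact_mod_cast hδ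
  set w : X → ℝ≥0∞ := fun x => ((δ : ℝ≥0∞)⁻¹ * potential G ω x) ^ (1 - q)⁻¹ with hw
  have hwm : Measurable w := (hω.const_mul _).pow_const _
  have hwpow : ∀ x, ((δ : ℝ≥0∞)⁻¹ * potential G ω x) ^ ((γ + q) / (1 - q)) = w x ^ (γ + q) := by
    intro x
    rw [hw, ← ENNReal.rpow_mul, inv_mul_eq_div]
  have hmeas : ∀ (α : Measure X) (f : X → ℝ≥0∞) (s : ℝ), Measurable fun t : ℝ =>
      α {x | ENNReal.ofReal t < f x} * ENNReal.ofReal (t ^ (s - 1)) := fun α f s =>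
    (measurable_measure_ofReal_lt α f).mul (by fun_prop)
  simp_rw [hwpow]
  rw [lintegral_rpow_eq_lintegral_meas_ofReal_lt_mul ω (hν.min measurable_const) hs,
    lintegral_rpow_eq_lintegral_meas_ofReal_lt_mul ω hwm hs,
    lintegral_rpow_eq_lintegral_meas_ofReal_lt_mul ν
      ((hν.const_mul _).min measurable_const) hγ]
  have hcoef : ENNReal.ofReal ((γ + q) / γ) * ENNReal.ofReal γ = ENNReal.ofReal (γ + q) := by
    rw [← ENNReal.ofReal_mul (by positivity), div_mul_cancel₀ _ hγ.ne']
  have hpt : ∀ t ∈ Set.Ioi (0 : ℝ),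
      ω {x | ENNReal.ofReal t < min (potential G ν x) N} * ENNReal.ofReal (t ^ (γ + q - 1))
        ≤ ω {x | ENNReal.ofReal t < w x} * ENNReal.ofReal (t ^ (γ + q - 1))
          + 2 * a * h * δ * (ν {x | ENNReal.ofReal t < min (2 * h * potential G ν x) N}
            * ENNReal.ofReal (t ^ (γ - 1))) := by
    intro t ht
    have ht' : 0 < t := ht
    rw [← ENNReal.ofReal_rpow_of_pos ht', ← ENNReal.ofReal_rpow_of_pos ht']
    set T := ENNReal.ofReal t with hT
    have hT0 : T ≠ 0 := by simpa [hT] using ht'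
    have hTtop : T ≠ ∞ := ENNReal.ofReal_ne_top
    rcases le_or_gt N T with hN | hN
    · have : {x | T < min (potential G ν x) N} = ∅ := by
        ext x
        simp [hN]
      rw [this]
      simp only [measure_empty, zero_mul]
      exact zero_le
    have hS : {x | T < min (2 * h * potential G ν x) N} = {x | T < 2 * h * potential G ν x} := by
      ext x
      simp [hN]
    rw [hS]
    set F := {x | T < potential G ν x ∧ potential G ω x ≤ δ * T ^ (1 - q)} with hF
    have hsub : {x | T < min (potential G ν x) N} ⊆ {x | T < w x} ∪ F := by
      intro x hx
      by_cases hx2 : potential G ω x ≤ δ * T ^ (1 - q)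
      · exact Or.inr ⟨(lt_min_iff.1 hx).1, hx2⟩
      · left
        have h3 : T ^ (1 - q) < (δ : ℝ≥0∞)⁻¹ * potential G ω x := by
          rw [mul_comm, ← div_eq_mul_inv,
            ENNReal.lt_div_iff_mul_lt (Or.inl hδ0) (Or.inl ENNReal.coe_ne_top), mul_comm]
          exact not_le.1 hx2
        exact (ENNReal.lt_rpow_inv_iff hq).2 h3
    have hlevel := mul_measure_potential_gt_inter_le hG h1 hmax ha ω ν hT0 hTtop
      (τ := δ * T ^ (1 - q))
      (mul_ne_zero hδ0 (ENNReal.rpow_pos (pos_iff_ne_zero.2 hT0) hTtop).ne')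
    calc ω {x | T < min (potential G ν x) N} * T ^ (γ + q - 1)
        ≤ (ω {x | T < w x} + ω F) * T ^ (γ + q - 1) := by
          gcongr
          exact (measure_mono hsub).trans (measure_union_le _ _)
      _ = ω {x | T < w x} * T ^ (γ + q - 1) + T * ω F * T ^ (γ + q - 2) := by
          have : T ^ (γ + q - 1) = T * T ^ (γ + q - 2) := by
            conv_rhs => rw [← ENNReal.rpow_one T, ← ENNReal.rpow_mul, one_mul]
            rw [← ENNReal.rpow_add _ _ hT0 hTtop]
            congr 1
            ring
          rw [add_mul]
          nth_rewrite 2 [this]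
          ring
      _ ≤ ω {x | T < w x} * T ^ (γ + q - 1)
          + 2 * a * h * (δ * T ^ (1 - q)) * ν {x | T < 2 * h * potential G ν x}
            * T ^ (γ + q - 2) := by gcongr
      _ = _ := by
          have : T ^ (γ - 1) = T ^ (1 - q) * T ^ (γ + q - 2) := by
            rw [← ENNReal.rpow_add _ _ hT0 hTtop]
            congr 1
            ring
          rw [this]
          ring
  calc ENNReal.ofReal (γ + q) * ∫⁻ t in Set.Ioi (0 : ℝ),
        ω {x | ENNReal.ofReal t < min (potential G ν x) N} * ENNReal.ofReal (t ^ (γ + q - 1))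
      ≤ ENNReal.ofReal (γ + q) * ∫⁻ t in Set.Ioi (0 : ℝ),
        (ω {x | ENNReal.ofReal t < w x} * ENNReal.ofReal (t ^ (γ + q - 1))
          + 2 * a * h * δ * (ν {x | ENNReal.ofReal t < min (2 * h * potential G ν x) N}
            * ENNReal.ofReal (t ^ (γ - 1)))) := by
        refine mul_le_mul_right ?_ _
        exact setLIntegral_mono' measurableSet_Ioi hpt
    _ = _ := by
        rw [lintegral_add_left (hmeas _ _ _),
          lintegral_const_mul _ (hmeas _ _ _), mul_add, ← hcoef]
        ring

end Comparison

/-! ### Weighted norm inequalities -/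

section NormInequalities

theorem add_rpow_le_two_rpow_mul (x y : ℝ≥0∞) {s : ℝ} (hs : 0 ≤ s) :
    (x + y) ^ s ≤ 2 ^ s * (x ^ s + y ^ s) := by
  rcases le_total x y with hxy | hxy
  · calc (x + y) ^ s ≤ (2 * y) ^ s := by rw [two_mul]; gcongr
      _ = 2 ^ s * y ^ s := ENNReal.mul_rpow_of_nonneg _ _ hs
      _ ≤ _ := by gcongr; exact le_add_self
  · calc (x + y) ^ s ≤ (2 * x) ^ s := by rw [two_mul]; gcongr
      _ = 2 ^ s * x ^ s := ENNReal.mul_rpow_of_nonneg _ _ hs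
      _ ≤ _ := by gcongr; exact le_self_add

theorem rpow_mul_rpow_le_add_rpow (x y : ℝ≥0∞) {p q : ℝ} (hp : 0 ≤ p) (hq : 0 ≤ q) :
    x ^ p * y ^ q ≤ x ^ (p + q) + y ^ (p + q) := by
  rcases le_total x y with hxy | hxy
  · calc x ^ p * y ^ q ≤ y ^ p * y ^ q := by gcongr
      _ = y ^ (p + q) := (ENNReal.rpow_add_of_nonneg _ _ hp hq).symm
      _ ≤ _ := le_add_self
  · calc x ^ p * y ^ q ≤ x ^ p * x ^ q := by gcongr
      _ = x ^ (p + q) := (ENNReal.rpow_add_of_nonneg _ _ hp hq).symm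
      _ ≤ _ := le_self_add

theorem le_two_mul_of_le_add_half {x d : ℝ≥0∞} (hx : x ≠ ∞) (h : x ≤ d + x / 2) : x ≤ 2 * d := by
  have h2 : x / 2 + x / 2 ≤ d + x / 2 := by rwa [ENNReal.add_halves]
  have h3 : x / 2 ≤ d :=
    (ENNReal.add_le_add_iff_right (ENNReal.div_ne_top hx two_ne_zero)).1 h2
  calc x = 2 * (x / 2) := (ENNReal.mul_div_cancel two_ne_zero ENNReal.ofNat_ne_top).symm
    _ ≤ 2 * d := by gcongr

variable [SecondCountableTopology X] [BorelSpace X]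

/-- For `q = 0` this compares the mutual energy `∫ (Gν)^γ dω` with the energies of `ω` and `ν`. -/
theorem exists_lintegral_potential_rpow_le_add
    (hG : LowerSemicontinuous (Function.uncurry G)) {h : ℝ≥0} (h1 : 1 ≤ h)
    (hmax : MaximumPrincipleWith G h) {a : ℝ≥0} (ha : ∀ x y, G x y ≤ a * G y x)
    {q γ : ℝ} (hq0 : 0 ≤ q) (hq1 : q < 1) (hγ : 0 < γ) :
    ∃ C : ℝ≥0, ∀ (ω ν : Measure X) [SFinite ω] [SFinite ν],
      ∫⁻ x, potential G ν x ^ (γ + q) ∂ω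
        ≤ ∫⁻ x, potential G ω x ^ ((γ + q) / (1 - q)) ∂ω + C * ∫⁻ x, potential G ν x ^ γ ∂ν := by
  set C : ℝ≥0∞ := 2 * a * h * ENNReal.ofReal ((γ + q) / γ) * (2 * h : ℝ≥0∞) ^ γ with hC
  have hCtop : C ≠ ∞ := by
    have : (2 * h : ℝ≥0∞) ^ γ ≠ ∞ := ENNReal.rpow_ne_top_of_nonneg hγ.le (by finiteness)
    finiteness
  refine ⟨C.toNNReal, fun ω ν _ _ => ?_⟩
  rw [ENNReal.coe_toNNReal hCtop]
  have := lintegral_min_potential_rpow_le hG h1 hmax ha ω ν hq0 hq1 hγ one_ne_zero ∞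
  simp only [ENNReal.coe_one, inv_one, one_mul, min_top_right, mul_one,
    ENNReal.mul_rpow_of_nonneg _ _ hγ.le] at this
  rw [← ENNReal.mul_rpow_of_nonneg _ _ hγ.le, lintegral_const_mul _
    ((measurable_potential hG ν).pow_const _)] at this
  refine this.trans (le_of_eq ?_)
  rw [hC]
  ring

/-- For a finite measure and a truncated potential the term `∫ min (Gν) N ^ (γ + q) dσ`, which
appears on both sides after `(Gν)^γ u^q ≤ (Gν)^(γ + q) + u^(γ + q)`, is finite and can be
absorbed. -/
theorem exists_lintegral_min_potential_withDensity_rpow_le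
    (hG : LowerSemicontinuous (Function.uncurry G)) {h : ℝ≥0} (h1 : 1 ≤ h)
    (hmax : MaximumPrincipleWith G h) {a : ℝ≥0} (ha : ∀ x y, G x y ≤ a * G y x)
    {q γ : ℝ} (hq0 : 0 < q) (hq1 : q < 1) (hγ : 0 < γ) {ε : ℝ≥0} (hε : ε ≠ 0) :
    ∃ C : ℝ≥0, ∀ (σ : Measure X) [IsFiniteMeasure σ] (u : X → ℝ≥0∞) (N : ℝ≥0), Measurable u →
      ∫⁻ x, min (potential G (σ.withDensity fun y => u y ^ q) x) N ^ (γ + q) ∂σ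
        ≤ C * ∫⁻ x, potential G σ x ^ ((γ + q) / (1 - q)) ∂σ + ε * ∫⁻ x, u x ^ (γ + q) ∂σ := by
  have hs : 0 < γ + q := by linarith
  have he : 0 < (γ + q) / (1 - q) := div_pos hs (by linarith)
  set K : ℝ≥0∞ := 2 * a * h * ENNReal.ofReal ((γ + q) / γ) * (2 * h : ℝ≥0∞) ^ γ with hK
  have hKtop : K ≠ ∞ := by
    have : (2 * h : ℝ≥0∞) ^ γ ≠ ∞ := ENNReal.rpow_ne_top_of_nonneg hγ.le (by finiteness)
    finiteness
  obtain ⟨δ, hδ0, hδ⟩ := ENNReal.exists_nnreal_pos_mul_lt hKtop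
    (b := min 2⁻¹ (ε / 2 : ℝ≥0∞)) (by simp [hε])
  have hδne : (δ : ℝ≥0∞) ≠ 0 := by exact_mod_cast hδ0.ne'
  set D : ℝ≥0∞ := (δ : ℝ≥0∞)⁻¹ ^ ((γ + q) / (1 - q)) with hD
  have hDtop : D ≠ ∞ := ENNReal.rpow_ne_top_of_nonneg he.le (ENNReal.inv_ne_top.2 hδne)
  refine ⟨2 * D.toNNReal, fun σ _ u N hu => ?_⟩
  push_cast
  rw [ENNReal.coe_toNNReal hDtop]
  set ν := σ.withDensity fun y => u y ^ q with hν
  have hνm := measurable_potential hG ν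
  set Z := ∫⁻ x, min (potential G ν x) N ^ (γ + q) ∂σ with hZ
  set Y := ∫⁻ x, u x ^ (γ + q) ∂σ with hY
  have hZtop : Z ≠ ∞ := by
    refine ne_top_of_le_ne_top (b := (N : ℝ≥0∞) ^ (γ + q) * σ Set.univ) ?_ ?_
    · have : (N : ℝ≥0∞) ^ (γ + q) ≠ ∞ := ENNReal.rpow_ne_top_of_nonneg hs.le ENNReal.coe_ne_top
      finiteness
    · rw [← lintegral_const]
      exact lintegral_mono fun x => ENNReal.rpow_le_rpow (min_le_right _ _) hs.le
  have h12 : (1 : ℝ≥0∞) ≤ 2 * h := by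
    have : (1 : ℝ≥0∞) ≤ h := by exact_mod_cast h1
    calc (1 : ℝ≥0∞) = 1 * 1 := (one_mul 1).symm
      _ ≤ 2 * h := mul_le_mul' one_le_two this
  have hsum : Measurable fun x => min (potential G ν x) N ^ (γ + q) + u x ^ (γ + q) :=
    ((hνm.min measurable_const).pow_const _).add (hu.pow_const _)
  have henergy : ∫⁻ x, min (2 * h * potential G ν x) N ^ γ ∂ν ≤ (2 * h : ℝ≥0∞) ^ γ * (Z + Y) := by
    rw [hν, lintegral_withDensity_eq_lintegral_mul _ (hu.pow_const _)
      (((measurable_potential hG _).const_mul _).min measurable_const |>.pow_const _), ← hν, hZ, hY,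
      ← lintegral_add_left ((hνm.min measurable_const).pow_const _),
      ← lintegral_const_mul _ hsum]
    refine lintegral_mono fun x => ?_
    have hmin : min (2 * h * potential G ν x) N ≤ 2 * h * min (potential G ν x) N := by
      rcases le_total (potential G ν x) N with hle | hle
      · rw [min_eq_left hle]
        exact min_le_left _ _
      · rw [min_eq_right hle]
        exact (min_le_right _ _).trans (le_mul_of_one_le_left zero_le h12)
    calc u x ^ q * min (2 * h * potential G ν x) N ^ γ
        ≤ u x ^ q * (2 * h * min (potential G ν x) N) ^ γ := by gcongr
      _ = (2 * h : ℝ≥0∞) ^ γ * (min (potential G ν x) N ^ γ * u x ^ q) := by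
          rw [ENNReal.mul_rpow_of_nonneg _ _ hγ.le]
          ring
      _ ≤ _ := by
          gcongr
          exact rpow_mul_rpow_le_add_rpow _ _ hγ.le hq0.le
  have hmain := lintegral_min_potential_rpow_le hG h1 hmax ha σ ν hq0.le hq1 hγ hδ0.ne' (N : ℝ≥0∞)
  simp only [ENNReal.mul_rpow_of_nonneg _ _ he.le] at hmain
  rw [lintegral_const_mul _ ((measurable_potential hG σ).pow_const _), ← hD, ← hZ] at hmain
  set M := ∫⁻ x, potential G σ x ^ ((γ + q) / (1 - q)) ∂σ with hM
  have hle : Z ≤ (D * M + ε / 2 * Y) + Z / 2 := by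
    calc Z ≤ D * M + 2 * a * h * δ * ENNReal.ofReal ((γ + q) / γ) *
            ((2 * h : ℝ≥0∞) ^ γ * (Z + Y)) := hmain.trans (by gcongr)
      _ = D * M + (δ * K * Z + δ * K * Y) := by rw [hK]; ring
      _ ≤ D * M + (2⁻¹ * Z + ε / 2 * Y) := by
          gcongr
          · exact hδ.le.trans (min_le_left _ _)
          · exact hδ.le.trans (min_le_right _ _)
      _ = _ := by rw [ENNReal.div_eq_inv_mul (a := Z)]; ring
  refine (le_two_mul_of_le_add_half hZtop hle).trans (le_of_eq ?_)
  rw [mul_add, ← mul_assoc, ← mul_assoc, ENNReal.mul_div_cancel two_ne_zero ENNReal.ofNat_ne_top]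

/-- The nonlinear operator `u ↦ G(u^q dσ)` on `L^(γ + q)(σ)`, with an arbitrarily small coefficient
in front of the norm of `u`. The truncated estimate for finite measures passes to the limit along
an exhaustion of the space by sets of finite measure. -/
theorem exists_lintegral_potential_withDensity_rpow_le
    (hG : LowerSemicontinuous (Function.uncurry G)) {h : ℝ≥0} (h1 : 1 ≤ h)
    (hmax : MaximumPrincipleWith G h) {a : ℝ≥0} (ha : ∀ x y, G x y ≤ a * G y x)
    {q γ : ℝ} (hq0 : 0 < q) (hq1 : q < 1) (hγ : 0 < γ) {ε : ℝ≥0} (hε : ε ≠ 0) :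
    ∃ C : ℝ≥0, ∀ (σ : Measure X) [SigmaFinite σ] (u : X → ℝ≥0∞), Measurable u →
      ∫⁻ x, potential G (σ.withDensity fun y => u y ^ q) x ^ (γ + q) ∂σ
        ≤ C * ∫⁻ x, potential G σ x ^ ((γ + q) / (1 - q)) ∂σ + ε * ∫⁻ x, u x ^ (γ + q) ∂σ := by
  have hs : 0 < γ + q := by linarith
  have he : 0 < (γ + q) / (1 - q) := div_pos hs (by linarith)
  obtain ⟨C, hC⟩ := exists_lintegral_min_potential_withDensity_rpow_le hG h1 hmax ha hq0 hq1 hγ hε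
  refine ⟨C, fun σ _ u hu => ?_⟩
  set ν := σ.withDensity fun y => u y ^ q with hν
  set A := spanningSets σ with hA
  have hAm : ∀ k, MeasurableSet (A k) := measurableSet_spanningSets σ
  have hAmono : Monotone A := monotone_spanningSets σ
  have hAev : ∀ x, ∀ᶠ k in Filter.atTop, x ∈ A k := fun x => by
    obtain ⟨k, hk⟩ : ∃ k, x ∈ A k :=
      Set.mem_iUnion.1 (by rw [hA, iUnion_spanningSets]; exact Set.mem_univ x)
    exact Filter.eventually_atTop.2 ⟨k, fun m hm => hAmono hm hk⟩
  -- Restriction to the exhausting sets, written with indicators.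
  have hind : ∀ (g : X → ℝ≥0∞) (x : X), Monotone fun k => (A k).indicator g x := fun g x k m hkm =>
    Set.indicator_le_indicator_of_subset (hAmono hkm) (fun _ => zero_le) x
  have hindt : ∀ (g : X → ℝ≥0∞) (x : X), Filter.Tendsto (fun k => (A k).indicator g x)
      Filter.atTop (nhds (g x)) := fun g x =>
    tendsto_const_nhds.congr' ((hAev x).mono fun k hk => (Set.indicator_of_mem hk g).symm)
  set p : ℕ → X → ℝ≥0∞ := fun k => potential G (ν.restrict (A k)) with hp
  have hpm : ∀ k, Measurable (p k) := fun k => measurable_potential hG _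
  have hpmono : ∀ x, Monotone fun k => p k x := fun x k m hkm =>
    lintegral_mono' (Measure.restrict_mono (hAmono hkm) le_rfl) le_rfl
  have hpt : ∀ x, Filter.Tendsto (fun k => p k x) Filter.atTop (nhds (potential G ν x)) := by
    intro x
    have : ∀ k, p k x = ∫⁻ y, (A k).indicator (G x) y ∂ν := fun k =>
      (lintegral_indicator (hAm k) _).symm
    simp_rw [this]
    exact lintegral_tendsto_of_tendsto_of_monotone
      (fun k => ((measurable_kernel_left hG x).indicator (hAm k)).aemeasurable)
      (.of_forall fun y => hind _ y) (.of_forall fun y => hindt _ y)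
  have hlim : Filter.Tendsto
      (fun k : ℕ => ∫⁻ x, (A k).indicator (fun x => min (p k x) k ^ (γ + q)) x ∂σ)
      Filter.atTop (nhds (∫⁻ x, potential G ν x ^ (γ + q) ∂σ)) := by
    refine lintegral_tendsto_of_tendsto_of_monotone
      (fun k => ((((hpm k).min measurable_const).pow_const _).indicator (hAm k)).aemeasurable)
      (.of_forall fun x k m hkm => ?_) (.of_forall fun x => ?_)
    · refine (hind _ x hkm).trans (Set.indicator_le_indicator ?_)
      exact ENNReal.rpow_le_rpow (min_le_min (hpmono x hkm) (by exact_mod_cast hkm)) hs.le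
    · have : Filter.Tendsto (fun k : ℕ => min (p k x) k ^ (γ + q)) Filter.atTop
          (nhds (potential G ν x ^ (γ + q))) := by
        have := ((hpt x).min ENNReal.tendsto_nat_nhds_top).ennrpow_const (γ + q)
        simpa using this
      exact this.congr' ((hAev x).mono fun k hk =>
        (Set.indicator_of_mem hk (fun x => min (p k x) k ^ (γ + q))).symm)
  refine le_of_tendsto' hlim fun k => ?_
  have : IsFiniteMeasure (σ.restrict (A k)) :=
    ⟨by simpa using measure_spanningSets_lt_top σ k⟩
  have hk := hC (σ.restrict (A k)) u k hu
  rw [← restrict_withDensity (hAm k)] at hk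
  rw [lintegral_indicator (hAm k)]
  refine (le_trans (le_of_eq ?_) hk).trans ?_
  · simp [hp, hν]
  · refine add_le_add (mul_le_mul_right ?_ _) (mul_le_mul_right ?_ _)
    · refine lintegral_mono' Measure.restrict_le_self fun x => ?_
      exact ENNReal.rpow_le_rpow (potential_restrict_le _ _ _) he.le
    · exact setLIntegral_le_lintegral _ _

end NormInequalities

/-! ### Existence of solutions -/

section Existence

variable [SecondCountableTopology X] [BorelSpace X]

/-- The right-hand side `v ↦ G(v^q dσ) + Gμ` of the integral equation. -/
noncomputable def equationMap (G : X → X → ℝ≥0∞) (σ μ : Measure X) (q : ℝ) (v : X → ℝ≥0∞) (x : X) :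
    ℝ≥0∞ :=
  potential G (σ.withDensity fun y => v y ^ q) x + potential G μ x

omit [TopologicalSpace X] [SecondCountableTopology X] [BorelSpace X] in
theorem monotone_equationMap (σ μ : Measure X) {q : ℝ} (hq : 0 ≤ q) :
    Monotone (equationMap G σ μ q) := fun v w hvw x => by
  refine add_le_add_left (lintegral_mono' (withDensity_mono ?_) le_rfl) _
  exact .of_forall fun y => ENNReal.rpow_le_rpow (hvw y) hq

theorem measurable_equationMap (hG : LowerSemicontinuous (Function.uncurry G)) (σ μ : Measure X)
    (q : ℝ) (v : X → ℝ≥0∞) : Measurable (equationMap G σ μ q v) :=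
  (measurable_potential hG _).add (measurable_potential hG _)

/-- Monotone iteration from a positive subsolution. -/
theorem exists_isPositiveSolution_of_le_equationMap
    (hG : LowerSemicontinuous (Function.uncurry G)) (σ μ : Measure X) {q : ℝ} (hq : 0 < q)
    {u₀ : X → ℝ≥0∞} (hu₀ : Measurable u₀) (hpos : ∀ x, 0 < u₀ x)
    (hsub : u₀ ≤ equationMap G σ μ q u₀) {s : ℝ} (hs : 0 < s) {B : ℝ≥0∞}
    (hB : ∀ k, ∫⁻ x, (equationMap G σ μ q)^[k] u₀ x ^ s ∂σ ≤ B) :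
    ∃ u, IsPositiveSolution G σ μ q u ∧ ∫⁻ x, u x ^ s ∂σ ≤ B := by
  set v : ℕ → X → ℝ≥0∞ := fun k => (equationMap G σ μ q)^[k] u₀ with hv
  have hmono : Monotone v := (monotone_equationMap σ μ hq.le).monotone_iterate_of_le_map hsub
  have hsucc : ∀ k, v (k + 1) = equationMap G σ μ q (v k) := fun k =>
    Function.iterate_succ_apply' _ _ _
  have hvm : ∀ k, Measurable (v k) := fun k => by
    cases k with
    | zero => exact hu₀
    | succ k => rw [hsucc]; exact measurable_equationMap hG σ μ q _
  set u : X → ℝ≥0∞ := fun x => ⨆ k, v k x with hu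
  have hum : Measurable u := Measurable.iSup hvm
  have hupos : ∀ x, 0 < u x := fun x => (hpos x).trans_le (le_iSup (fun k => v k x) 0)
  have htend : ∀ x, Filter.Tendsto (fun k => v k x) Filter.atTop (nhds (u x)) := fun x =>
    tendsto_atTop_iSup fun k m hkm => hmono hkm x
  refine ⟨u, ⟨hum, hupos, fun x => ?_⟩, ?_⟩
  · have h1 : Filter.Tendsto (fun k => v (k + 1) x) Filter.atTop (nhds (u x)) :=
      (htend x).comp (Filter.tendsto_add_atTop_nat 1)
    have hGx := measurable_kernel_left hG x
    have h2 : Filter.Tendsto (fun k => equationMap G σ μ q (v k) x) Filter.atTop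
        (nhds (equationMap G σ μ q u x)) := by
      refine Filter.Tendsto.add_const _ ?_
      simp_rw [potential_withDensity hG σ ((hvm _).pow_const q) x]
      rw [potential_withDensity hG σ (hum.pow_const q) x]
      refine lintegral_tendsto_of_tendsto_of_monotone
        (fun k => (hGx.mul ((hvm k).pow_const q)).aemeasurable)
        (.of_forall fun y k m hkm => mul_le_mul_right
          (ENNReal.rpow_le_rpow (hmono hkm y) hq.le) _) (.of_forall fun y => ?_)
      refine ENNReal.Tendsto.const_mul ((htend y).ennrpow_const q) (Or.inl ?_)
      -- `G x y` may be infinite; continuity of the product uses `u y ≠ 0`.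
      simpa [ENNReal.rpow_eq_zero_iff, hq, hq.not_gt] using (hupos y).ne'
    simp_rw [hsucc] at h1
    exact tendsto_nhds_unique h1 h2
  · exact le_of_tendsto' (lintegral_tendsto_of_tendsto_of_monotone
      (fun k => ((hvm k).pow_const s).aemeasurable)
      (.of_forall fun x k m hkm => ENNReal.rpow_le_rpow (hmono hkm x) hs.le)
      (.of_forall fun x => (htend x).ennrpow_const s)) hB

/-- A small multiple of `(Gσ)^{1/(1-q)}` is a subsolution. -/
theorem exists_mul_rpow_le_potential
    (hG : LowerSemicontinuous (Function.uncurry G)) {h : ℝ≥0} (h1 : 1 ≤ h)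
    (hmax : MaximumPrincipleWith G h) {q : ℝ} (hq0 : 0 < q) (hq1 : q < 1) (σ : Measure X) :
    ∃ c : ℝ≥0, c ≠ 0 ∧ ∀ x, c * potential G σ x ^ (1 - q)⁻¹ ≤
      potential G (σ.withDensity fun y => (c * potential G σ y ^ (1 - q)⁻¹) ^ q) x := by
  have hq : 0 < 1 - q := by linarith
  set r : ℝ := (1 - q)⁻¹ with hr
  have hr1 : 1 ≤ r := (one_le_inv₀ hq).2 (by linarith)
  have hrq : r * q = r - 1 := by
    rw [hr]; field_simp; ring
  set A : ℝ≥0∞ := 2 * (2 * h : ℝ≥0∞) ^ (r - 1) with hA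
  have h20 : (2 * h : ℝ≥0∞) ≠ 0 := by
    simpa using (zero_lt_one.trans_le h1).ne'
  have h2top : (2 * h : ℝ≥0∞) ≠ ∞ := by finiteness
  have hAtop : A ≠ ∞ := by
    have : (2 * h : ℝ≥0∞) ^ (r - 1) ≠ ∞ :=
      ENNReal.rpow_ne_top_of_nonneg (by linarith) h2top
    finiteness
  have hA0 : A ≠ 0 :=
    mul_ne_zero two_ne_zero (ENNReal.rpow_pos (pos_iff_ne_zero.2 h20) h2top).ne'
  have hAi0 : A⁻¹ ≠ 0 := ENNReal.inv_ne_zero.2 hAtop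
  have hAitop : A⁻¹ ≠ ∞ := ENNReal.inv_ne_top.2 hA0
  -- `c = A ^ (-r)` solves `c ^ q * A⁻¹ = c`.
  set c : ℝ≥0∞ := A⁻¹ ^ r with hc
  have hctop : c ≠ ∞ := ENNReal.rpow_ne_top_of_nonneg (by linarith) hAitop
  have hc0 : c ≠ 0 := (ENNReal.rpow_pos (pos_iff_ne_zero.2 hAi0) hAitop).ne'
  have hcq : c ^ q * A⁻¹ = c := by
    rw [hc, ← ENNReal.rpow_mul, hrq]
    conv_lhs => rw [← ENNReal.rpow_one A⁻¹, ← ENNReal.rpow_mul, one_mul]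
    rw [← ENNReal.rpow_add _ _ hAi0 hAitop, sub_add_cancel]
  refine ⟨c.toNNReal, (ENNReal.toNNReal_ne_zero).2 ⟨hc0, hctop⟩, fun x => ?_⟩
  rw [ENNReal.coe_toNNReal hctop]
  have hm := measurable_potential hG σ
  have hGx := measurable_kernel_left hG x
  have hpow : ∀ y, (c * potential G σ y ^ r) ^ q = c ^ q * potential G σ y ^ (r - 1) := fun y => by
    rw [ENNReal.mul_rpow_of_nonneg _ _ hq0.le, ← ENNReal.rpow_mul (potential G σ y),
      hrq]
  simp_rw [hpow]
  set R := potential G (σ.withDensity fun y => potential G σ y ^ (r - 1)) x with hR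
  have hright : potential G (σ.withDensity fun y => c ^ q * potential G σ y ^ (r - 1)) x
      = c ^ q * R := by
    have hgm : Measurable fun y => G x y * potential G σ y ^ (r - 1) := hGx.mul (hm.pow_const _)
    rw [hR, potential_withDensity hG _ ((hm.pow_const _).const_mul _),
      potential_withDensity hG _ (hm.pow_const _), ← lintegral_const_mul _ hgm]
    exact lintegral_congr fun y => by ring
  rw [hright]
  calc c * potential G σ x ^ r = c ^ q * (A⁻¹ * potential G σ x ^ r) := by
        rw [← mul_assoc, hcq]
    _ ≤ c ^ q * (A⁻¹ * (A * R)) := by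
        gcongr
        exact rpow_potential_le hG h1 hmax σ hr1 x
    _ = c ^ q * R := by
        rw [← mul_assoc A⁻¹, ENNReal.inv_mul_cancel hA0 hAtop, one_mul]

theorem exists_isPositiveSolution
    (hG : LowerSemicontinuous (Function.uncurry G)) (hpos : ∀ x y, 0 < G x y)
    {h : ℝ≥0} (h1 : 1 ≤ h)
    (hmax : MaximumPrincipleWith G h) {a : ℝ≥0} (ha : ∀ x y, G x y ≤ a * G y x)
    {q γ : ℝ} (hq0 : 0 < q) (hq1 : q < 1) (hγ : 0 < γ)
    (σ μ : Measure X) [SigmaFinite σ] [SFinite μ] (hσ : σ ≠ 0)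
    (hσint : ∫⁻ x, potential G σ x ^ ((γ + q) / (1 - q)) ∂σ ≠ ∞)
    (hμint : ∫⁻ x, potential G μ x ^ γ ∂μ ≠ ∞) :
    ∃ u, IsPositiveSolution G σ μ q u ∧ ∫⁻ x, u x ^ (γ + q) ∂σ < ∞ ∧ ∫⁻ x, u x ^ γ ∂μ < ∞ := by
  have hs : 0 < γ + q := by linarith
  have hq : 0 < 1 - q := by linarith
  have hσm := measurable_potential hG σ
  set M := ∫⁻ x, potential G σ x ^ ((γ + q) / (1 - q)) ∂σ with hM
  have h2s : (2 : ℝ≥0∞) ^ (γ + q) ≠ ∞ := ENNReal.rpow_ne_top_of_nonneg hs.le ENNReal.ofNat_ne_top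
  -- The datum `Gμ` belongs to `L^(γ + q)(σ)`.
  set P := ∫⁻ x, potential G μ x ^ (γ + q) ∂σ with hP
  have hPtop : P ≠ ∞ := by
    obtain ⟨C, hC⟩ := exists_lintegral_potential_rpow_le_add hG h1 hmax ha hq0.le hq1 hγ
    refine ne_top_of_le_ne_top ?_ (hC σ μ)
    finiteness
  obtain ⟨ε, hε0, hε⟩ := ENNReal.exists_nnreal_pos_mul_lt h2s (b := 2⁻¹) (by simp)
  obtain ⟨C, hC⟩ :=
    exists_lintegral_potential_withDensity_rpow_le hG h1 hmax ha hq0 hq1 hγ hε0.ne'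
  obtain ⟨c, hc0, hc⟩ := exists_mul_rpow_le_potential hG h1 hmax hq0 hq1 σ
  set u₀ : X → ℝ≥0∞ := fun x => c * potential G σ x ^ (1 - q)⁻¹ with hu₀
  have hu₀m : Measurable u₀ := (hσm.pow_const _).const_mul _
  have hu₀pos : ∀ x, 0 < u₀ x := fun x => by
    have := potential_pos hG hpos hσ x
    refine ENNReal.mul_pos (by exact_mod_cast hc0) ?_
    simpa [ENNReal.rpow_eq_zero_iff, hq, hq.le, hq.not_gt] using this.ne'
  set D : ℝ≥0∞ := 2 ^ (γ + q) * (C * M + P) with hD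
  have hDtop : D ≠ ∞ := by finiteness
  set Y₀ := ∫⁻ x, u₀ x ^ (γ + q) ∂σ with hY₀
  have hY₀top : Y₀ ≠ ∞ := by
    have : Y₀ = (c : ℝ≥0∞) ^ (γ + q) * M := by
      rw [hY₀, hM, ← lintegral_const_mul _ (hσm.pow_const _)]
      refine lintegral_congr fun x => ?_
      rw [hu₀, ENNReal.mul_rpow_of_nonneg _ _ hs.le, ← ENNReal.rpow_mul, inv_mul_eq_div]
    rw [this]
    exact ENNReal.mul_ne_top (ENNReal.rpow_ne_top_of_nonneg hs.le ENNReal.coe_ne_top) hσint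
  have hstep : ∀ v : X → ℝ≥0∞, Measurable v →
      ∫⁻ x, equationMap G σ μ q v x ^ (γ + q) ∂σ ≤ D + (∫⁻ x, v x ^ (γ + q) ∂σ) / 2 := by
    intro v hv
    have hgm : Measurable fun x =>
        potential G (σ.withDensity fun y => v y ^ q) x ^ (γ + q) :=
      (measurable_potential hG _).pow_const _
    calc ∫⁻ x, equationMap G σ μ q v x ^ (γ + q) ∂σ
        ≤ ∫⁻ x, 2 ^ (γ + q) * (potential G (σ.withDensity fun y => v y ^ q) x ^ (γ + q)
            + potential G μ x ^ (γ + q)) ∂σ :=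
          lintegral_mono fun x => add_rpow_le_two_rpow_mul _ _ hs.le
      _ = 2 ^ (γ + q) * (∫⁻ x, potential G (σ.withDensity fun y => v y ^ q) x ^ (γ + q) ∂σ
            + P) := by
          rw [lintegral_const_mul' _ _ h2s, lintegral_add_left hgm]
      _ ≤ 2 ^ (γ + q) * ((C * M + ε * ∫⁻ x, v x ^ (γ + q) ∂σ) + P) := by
          gcongr
          exact hC σ v hv
      _ = D + ε * 2 ^ (γ + q) * ∫⁻ x, v x ^ (γ + q) ∂σ := by rw [hD]; ring
      _ ≤ D + 2⁻¹ * ∫⁻ x, v x ^ (γ + q) ∂σ := by gcongr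
      _ = _ := by rw [ENNReal.div_eq_inv_mul]
  -- `2 * D + Y₀` bounds the initial value and is preserved by `Y ↦ D + Y / 2`.
  have hB : ∀ k, Measurable ((equationMap G σ μ q)^[k] u₀) ∧
      ∫⁻ x, (equationMap G σ μ q)^[k] u₀ x ^ (γ + q) ∂σ ≤ 2 * D + Y₀ := by
    intro k
    induction k with
    | zero => exact ⟨hu₀m, le_add_self⟩
    | succ k ih =>
      rw [Function.iterate_succ_apply']
      refine ⟨measurable_equationMap hG σ μ q _, (hstep _ ih.1).trans ?_⟩
      calc D + (∫⁻ x, (equationMap G σ μ q)^[k] u₀ x ^ (γ + q) ∂σ) / 2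
          ≤ D + (2 * D + Y₀) / 2 := by
            gcongr
            exact ih.2
        _ ≤ (2 * D + Y₀) / 2 + (2 * D + Y₀) / 2 := by
            gcongr
            calc D = 2 * D / 2 := by
                  rw [mul_div_assoc, ENNReal.mul_div_cancel two_ne_zero ENNReal.ofNat_ne_top]
              _ ≤ _ := ENNReal.div_le_div_right le_self_add _
        _ = 2 * D + Y₀ := ENNReal.add_halves _
  obtain ⟨u, hu, huB⟩ := exists_isPositiveSolution_of_le_equationMap hG σ μ hq0 hu₀m hu₀pos
    (fun x => (hc x).trans le_self_add) hs fun k => (hB k).2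
  have huσ : ∫⁻ x, u x ^ (γ + q) ∂σ < ∞ := huB.trans_lt (by finiteness)
  refine ⟨u, hu, huσ, ?_⟩
  -- The energy of `u^q dσ` is at most `∫ u^(γ + q) dσ`; compare it with that of `μ`.
  set ν := σ.withDensity fun y => u y ^ q with hν
  have hνm := measurable_potential hG ν
  have hνenergy : ∫⁻ x, potential G ν x ^ γ ∂ν ≤ ∫⁻ x, u x ^ (γ + q) ∂σ := by
    conv_lhs => rw [hν]
    rw [lintegral_withDensity_eq_lintegral_mul _ (hu.measurable.pow_const _)
      ((measurable_potential hG _).pow_const _), ← hν]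
    refine lintegral_mono fun x => ?_
    have hle : potential G ν x ≤ u x := by
      rw [hu.eq x]
      exact le_self_add
    calc u x ^ q * potential G ν x ^ γ ≤ u x ^ q * u x ^ γ := by gcongr
      _ = u x ^ (γ + q) := by rw [add_comm, ENNReal.rpow_add_of_nonneg _ _ hq0.le hγ.le]
  obtain ⟨C', hC'⟩ := exists_lintegral_potential_rpow_le_add hG h1 hmax ha le_rfl one_pos hγ
  have hmutual := hC' μ ν
  simp only [add_zero, sub_zero, div_one] at hmutual
  have h2γ : (2 : ℝ≥0∞) ^ γ ≠ ∞ := ENNReal.rpow_ne_top_of_nonneg hγ.le ENNReal.ofNat_ne_top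
  have huσ' := huσ.ne
  calc ∫⁻ x, u x ^ γ ∂μ
      ≤ ∫⁻ x, 2 ^ γ * (potential G ν x ^ γ + potential G μ x ^ γ) ∂μ := by
        refine lintegral_mono fun x => ?_
        conv_lhs => rw [hu.eq x]
        exact add_rpow_le_two_rpow_mul _ _ hγ.le
    _ = 2 ^ γ * (∫⁻ x, potential G ν x ^ γ ∂μ + ∫⁻ x, potential G μ x ^ γ ∂μ) := by
        rw [lintegral_const_mul' _ _ h2γ, lintegral_add_left (hνm.pow_const _)]
    _ ≤ 2 ^ γ * ((∫⁻ x, potential G μ x ^ γ ∂μ + C' * ∫⁻ x, u x ^ (γ + q) ∂σ)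
          + ∫⁻ x, potential G μ x ^ γ ∂μ) := by
        gcongr
        exact hmutual.trans (by gcongr)
    _ < ∞ := by finiteness

end Existence

/-! ### Necessity of the conditions -/

section Necessity

variable [SecondCountableTopology X] [BorelSpace X]

/-- Lower bound for supersolutions: with `ν = u^q dσ` one has `Gν ≤ u`, hence
`Gσ = G(u^{-q} dν) ≤ G((Gν)^{-q} dν)`. The first equality uses that `u` is finite `σ`-a.e. -/
theorem exists_potential_le_rpow_of_supersolution
    (hG : LowerSemicontinuous (Function.uncurry G)) (hpos : ∀ x y, 0 < G x y) {h : ℝ≥0}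
    (hmax : MaximumPrincipleWith G h) {q : ℝ} (hq0 : 0 < q) (hq1 : q < 1) :
    ∃ C : ℝ≥0, ∀ (σ : Measure X) (u : X → ℝ≥0∞), Measurable u → (∀ x, 0 < u x) →
      (∀ᵐ x ∂σ, u x ≠ ∞) → (∀ x, potential G (σ.withDensity fun y => u y ^ q) x ≤ u x) →
      ∀ x, potential G σ x ≤ C * u x ^ (1 - q) := by
  obtain ⟨C, hC⟩ := exists_potential_withDensity_rpow_neg_le hG hpos hmax hq0 hq1
  refine ⟨C, fun σ u hu hupos hfin hsup x => ?_⟩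
  set ν := σ.withDensity fun y => u y ^ q with hν
  have hνm := measurable_potential hG ν
  have hgm : Measurable fun y => G x y * potential G ν y ^ (-q) :=
    (measurable_kernel_left hG x).mul (hνm.pow_const _)
  calc potential G σ x ≤ ∫⁻ y, u y ^ q * (G x y * potential G ν y ^ (-q)) ∂σ := by
        refine lintegral_mono_ae (hfin.mono fun y hy => ?_)
        have hone : u y ^ q * u y ^ (-q) = 1 := by
          rw [← ENNReal.rpow_add _ _ (hupos y).ne' hy, add_neg_cancel, ENNReal.rpow_zero]
        have hle : u y ^ (-q) ≤ potential G ν y ^ (-q) := by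
          rw [ENNReal.rpow_neg, ENNReal.rpow_neg, ENNReal.inv_le_inv]
          exact ENNReal.rpow_le_rpow (hsup y) hq0.le
        calc G x y = u y ^ q * (G x y * u y ^ (-q)) := by
              rw [mul_left_comm, hone, mul_one]
          _ ≤ _ := by gcongr
    _ = ∫⁻ y, G x y * potential G ν y ^ (-q) ∂ν := by
        conv_rhs => rw [hν]
        exact (lintegral_withDensity_eq_lintegral_mul _ (hu.pow_const _) hgm).symm
    _ = potential G (ν.withDensity fun y => potential G ν y ^ (-q)) x :=
        (potential_withDensity hG _ (hνm.pow_const _) x).symm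
    _ ≤ C * potential G ν x ^ (1 - q) := hC ν x
    _ ≤ C * u x ^ (1 - q) := by
        refine mul_le_mul_right (ENNReal.rpow_le_rpow (hsup x) (by linarith)) _

theorem IsPositiveSolution.lintegral_potential_rpow_lt_top
    (hG : LowerSemicontinuous (Function.uncurry G)) (hpos : ∀ x y, 0 < G x y) {h : ℝ≥0}
    (hmax : MaximumPrincipleWith G h) {q γ : ℝ} (hq0 : 0 < q) (hq1 : q < 1) (hγ : 0 < γ)
    {σ μ : Measure X} {u : X → ℝ≥0∞} (hu : IsPositiveSolution G σ μ q u)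
    (huσ : ∫⁻ x, u x ^ (γ + q) ∂σ < ∞) (huμ : ∫⁻ x, u x ^ γ ∂μ < ∞) :
    ∫⁻ x, potential G σ x ^ ((γ + q) / (1 - q)) ∂σ < ∞ ∧ ∫⁻ x, potential G μ x ^ γ ∂μ < ∞ := by
  have hs : 0 < γ + q := by linarith
  have hq : 0 < 1 - q := by linarith
  have he : 0 ≤ (γ + q) / (1 - q) := (div_pos hs hq).le
  refine ⟨?_, (lintegral_mono fun x => ENNReal.rpow_le_rpow ?_ hγ.le).trans_lt huμ⟩
  · have hfin : ∀ᵐ x ∂σ, u x ≠ ∞ := by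
      filter_upwards [ae_lt_top (hu.measurable.pow_const _) huσ.ne] with x hx hxtop
      rw [hxtop, ENNReal.top_rpow_of_pos hs] at hx
      exact hx.ne rfl
    obtain ⟨C, hC⟩ := exists_potential_le_rpow_of_supersolution hG hpos hmax hq0 hq1
    have hle := hC σ u hu.measurable hu.pos hfin fun x => by
      conv_rhs => rw [hu.eq x]
      exact le_self_add
    have hCe : (C : ℝ≥0∞) ^ ((γ + q) / (1 - q)) ≠ ∞ :=
      ENNReal.rpow_ne_top_of_nonneg he ENNReal.coe_ne_top
    calc ∫⁻ x, potential G σ x ^ ((γ + q) / (1 - q)) ∂σ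
        ≤ ∫⁻ x, (C : ℝ≥0∞) ^ ((γ + q) / (1 - q)) * u x ^ (γ + q) ∂σ := by
          refine lintegral_mono fun x => (ENNReal.rpow_le_rpow (hle x) he).trans (le_of_eq ?_)
          rw [ENNReal.mul_rpow_of_nonneg _ _ he, ← ENNReal.rpow_mul, mul_div_cancel₀ _ hq.ne']
      _ = (C : ℝ≥0∞) ^ ((γ + q) / (1 - q)) * ∫⁻ x, u x ^ (γ + q) ∂σ :=
          lintegral_const_mul' _ _ hCe
      _ < ∞ := ENNReal.mul_lt_top hCe.lt_top huσ
  · rw [hu.eq x]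
    exact le_add_self

end Necessity

omit [TopologicalSpace X] in
theorem memLp_ofReal_iff {α : Measure X} {f : X → ℝ≥0∞} (hf : Measurable f) {p : ℝ} (hp : 0 < p) :
    MemLp f (ENNReal.ofReal p) α ↔ ∫⁻ x, f x ^ p ∂α < ∞ := by
  rw [MemLp, and_iff_right hf.aestronglyMeasurable, eLpNorm_lt_top_iff_lintegral_rpow_enorm_lt_top
    (by simpa using hp) ENNReal.ofReal_ne_top, ENNReal.toReal_ofReal hp.le]
  simp

end SublinearPotential

theorem theorem4p4 {n : ℕ} (Ω : Set (EuclideanSpace ℝ (Fin n)))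
    (hΩ_open : IsOpen Ω) (hΩ_conn : IsConnected Ω)
    (q γ : ℝ) (hq0 : 0 < q) (hq1 : q < 1) (hγ : 0 < γ)
    (σ μ : Measure Ω) [IsLocallyFiniteMeasure σ] [IsLocallyFiniteMeasure μ] (hσ : σ ≠ 0)
    (G : Ω → Ω → ℝ≥0∞) (hG_pos : ∀ x y, 0 < G x y)
    (hG_lsc : LowerSemicontinuous (Function.uncurry G))
    (hG_wmp : SublinearPotential.WeakMaximumPrinciple G) :
    (SublinearPotential.QuasiSymmetric G →
      MemLp (SublinearPotential.potential G σ) (ENNReal.ofReal ((γ + q) / (1 - q))) σ →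
      MemLp (SublinearPotential.potential G μ) (ENNReal.ofReal γ) μ →
      ∃ u : Ω → ℝ≥0∞, SublinearPotential.IsPositiveSolution G σ μ q u ∧
        MemLp u (ENNReal.ofReal (γ + q)) σ ∧ MemLp u (ENNReal.ofReal γ) μ) ∧
    ((∃ u : Ω → ℝ≥0∞, SublinearPotential.IsPositiveSolution G σ μ q u ∧
        MemLp u (ENNReal.ofReal (γ + q)) σ ∧ MemLp u (ENNReal.ofReal γ) μ) →
      MemLp (SublinearPotential.potential G σ) (ENNReal.ofReal ((γ + q) / (1 - q))) σ ∧
      MemLp (SublinearPotential.potential G μ) (ENNReal.ofReal γ) μ) := by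
  have hs : 0 < γ + q := by linarith
  have he : 0 < (γ + q) / (1 - q) := div_pos hs (by linarith)
  obtain ⟨h, h1, hmax⟩ := hG_wmp.exists_maximumPrincipleWith hG_lsc hG_pos
  rw [SublinearPotential.memLp_ofReal_iff (SublinearPotential.measurable_potential hG_lsc σ) he,
    SublinearPotential.memLp_ofReal_iff (SublinearPotential.measurable_potential hG_lsc μ) hγ]
  constructor
  · rintro ⟨a, -, ha⟩ hσint hμint
    obtain ⟨u, hu, huσ, huμ⟩ := SublinearPotential.exists_isPositiveSolution hG_lsc hG_pos h1 hmax
      (fun x y => (ha x y).2) hq0 hq1 hγ σ μ hσ hσint.ne hμint.ne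
    exact ⟨u, hu, (SublinearPotential.memLp_ofReal_iff hu.measurable hs).2 huσ,
      (SublinearPotential.memLp_ofReal_iff hu.measurable hγ).2 huμ⟩
  · rintro ⟨u, hu, huσ, huμ⟩
    exact hu.lintegral_potential_rpow_lt_top hG_lsc hG_pos hmax hq0 hq1 hγ
      ((SublinearPotential.memLp_ofReal_iff hu.measurable hs).1 huσ)
      ((SublinearPotential.memLp_ofReal_iff hu.measurable hγ).1 huμ)
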